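/- Let $\mu$ be a probability measure on $\mathbb R$ that is absolutely continuous with respect to Lebesgue measure, and let $\mu^n$ be its $n$-fold product on $\mathbb R^n$. Let $H:\mathbb R\to[0,\infty)$ be an even convex function with $H(0)=0$ such that $x\mapsto H(x)/x^2$ is non-decreasing on $(0,\infty)$ and such that the conjugate $H^*(y)=\sup_{x\ge 0}\{x|y|-H(x)\}$ is (finite and) strictly convex on $\mathbb R$. Put $$\omega_H(x)=\sup_{t>0}\frac{H(tx)}{H(t)}\in[0,\infty]\quad(x\ge 0),\qquad \omega_H^*(y)=\sup_{x\ge 0}\{xy-\omega_H(x)\}\quad(y\ge0),$$ where $0/0=0$ and $c/0=\infty$ for $c>0$. Let $\mathrm{Ent}_\mu(g)=\int g\log g\,d\mu-\big(\int g\,d\mu\big)\log\big(\int g\,d\mu\big)$, and suppose that $\kappa\in[0,\infty)$ is such that $$\mathrm{Ent}_\mu(f^2)\le\kappa\int H\Big(\frac{f'}{f}\Big)f^2\,d\mu$$ for every locally Lipschitz $f:\mathbb R\to\mathbb R$ for which $f^2$ and $f^2\log f^2$ are $\mu$-integrable (the right-hand side may be $+\infty$; the integrand is $0$ where $f=0$).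 Set $$K=\omega_H(2)\,\kappa\;\omega_H^*\Big(\frac{1}{\omega_H(2)\,\kappa}\Big),$$ with $K=0$ if $\omega_H(2)=\infty$ or $\kappa=0$. Then $K$ is finite, and for every $n$, every Borel set $A\subset\mathbb R^n$ with $\mu^n(A)\ge\frac12$ and every $r\ge0$, $$1-\mu^n\Big(A+\Big\{x\in\mathbb R^n:\ \sum_{i=1}^n H^*(x_i)<r\Big\}\Big)\le e^{-Kr}.$$ -/

import Mathlib

open MeasureTheory Set
open scoped ENNReal NNReal Pointwise

/-- The conjugate (Legendre transform) `H*(y) = sup_{x ≥ 0} (x |y| - H x)` of an even function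
`H`. It is used for functions for which this supremum is finite, see `bddAbove_legendre`. -/
noncomputable def legendre (H : ℝ → ℝ) (y : ℝ) : ℝ :=
  ⨆ x : ℝ≥0, ((x : ℝ) * |y| - H x)

/-- `ω_H(x) = sup_{t > 0} H(t x) / H(t)` for `x ≥ 0`, with values in `[0, ∞]`. -/
noncomputable def omegaFun (H : ℝ → ℝ) (x : ℝ≥0) : ℝ≥0∞ :=
  ⨆ (t : ℝ) (_ : 0 < t), ENNReal.ofReal (H (t * x)) / ENNReal.ofReal (H t)

/-- The conjugate `ω*(y) = sup_{x ≥ 0} (x y - ω x)` of a function `ω : [0, ∞) → [0, ∞]` with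
`ω 0 = 0`. The subtraction is truncated at `0`, which does not change the supremum, because the
term with `x = 0` is `0`. -/
noncomputable def conjRay (ω : ℝ≥0 → ℝ≥0∞) (y : ℝ≥0∞) : ℝ≥0∞ :=
  ⨆ x : ℝ≥0, ((x : ℝ≥0∞) * y - ω x)

/-- The constant `K = ω_H(2) κ ω_H*(1 / (ω_H(2) κ))`. If `ω_H(2) = ∞` this is
`∞ * ω_H*(0) = ∞ * 0 = 0`. -/
noncomputable def concConst (H : ℝ → ℝ) (κ : ℝ≥0) : ℝ≥0∞ :=
  omegaFun H 2 * κ * conjRay (omegaFun H) (1 / (omegaFun H 2 * κ))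

/-- The entropy `Ent_μ(g) = ∫ g log g dμ - (∫ g dμ) log (∫ g dμ)`. -/
noncomputable def entropy (μ : Measure ℝ) (g : ℝ → ℝ) : ℝ :=
  ∫ x, g x * Real.log (g x) ∂μ - (∫ x, g x ∂μ) * Real.log (∫ x, g x ∂μ)

/-- The modified logarithmic Sobolev inequality
`Ent_μ(f²) ≤ κ ∫ H(f' / f) f² dμ`
for every locally Lipschitz `f : ℝ → ℝ` for which the entropy is defined and finite.
The right-hand side takes values in `[0, ∞]`; for `μ` absolutely continuous, the points where `f`
is not differentiable, or where `f = 0` and `f' ≠ 0`, form a `μ`-null set, and the integrand is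
`0` wherever `f = 0`. -/
def ModifiedLogSobolev (μ : Measure ℝ) (H : ℝ → ℝ) (κ : ℝ≥0) : Prop :=
  ∀ f : ℝ → ℝ, LocallyLipschitz f →
    Integrable (fun x => f x ^ 2) μ →
    Integrable (fun x => f x ^ 2 * Real.log (f x ^ 2)) μ →
    ENNReal.ofReal (entropy μ (fun x => f x ^ 2)) ≤
      κ * ∫⁻ x, ENNReal.ofReal (H (deriv f x / f x) * f x ^ 2) ∂μ

/-- Under the standing assumptions on `H` the supremum that defines `legendre H` is finite. -/
theorem bddAbove_legendre {H : ℝ → ℝ} (h_nonneg : ∀ x, 0 ≤ H x) (h_zero : H 0 = 0)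
    (h_mono : MonotoneOn (fun x => H x / x ^ 2) (Ioi 0))
    (h_strict : StrictConvexOn ℝ univ (legendre H)) (y : ℝ) :
    BddAbove (range fun x : ℝ≥0 => (x : ℝ) * |y| - H x) := by
  by_cases hH : ∀ x : ℝ, 0 < x → H x = 0
  · exfalso
    have hH' : ∀ x : ℝ≥0, H x = 0 := by
      intro x
      rcases eq_or_lt_of_le x.2 with h | h
      · have : (x : ℝ) = 0 := h.symm
        rw [this, h_zero]
      · exact hH _ h
    have hL : ∀ z : ℝ, legendre H z = 0 := by
      intro z
      unfold legendre
      rcases eq_or_ne z 0 with hz | hz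
      · simp [hz, hH']
      · apply Real.iSup_of_not_bddAbove
        rintro ⟨M, hM⟩
        have hz' : 0 < |z| := abs_pos.mpr hz
        have h0 : 0 < (|M| + 1) / |z| := by positivity
        have h1 : (|M| + 1) / |z| * |z| - H ((|M| + 1) / |z|) ≤ M :=
          hM ⟨⟨(|M| + 1) / |z|, h0.le⟩, rfl⟩
        rw [hH _ h0, sub_zero, div_mul_cancel₀ _ hz'.ne'] at h1
        linarith [le_abs_self M]
    have h2 := h_strict.2 (mem_univ (0 : ℝ)) (mem_univ (1 : ℝ)) zero_ne_one
      (by norm_num : (0 : ℝ) < 1 / 2) (by norm_num : (0 : ℝ) < 1 / 2) (by norm_num)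
    simp [hL] at h2
  · push Not at hH
    obtain ⟨t, ht, hHt⟩ := hH
    set c := H t / t ^ 2 with hc
    have hc0 : 0 < c := div_pos (lt_of_le_of_ne (h_nonneg t) (Ne.symm hHt)) (by positivity)
    refine ⟨t * |y| + y ^ 2 / (4 * c), ?_⟩
    rintro _ ⟨x, rfl⟩
    have hq : 0 ≤ y ^ 2 / (4 * c) := by positivity
    have hx : (0 : ℝ) ≤ x := x.2
    rcases le_total (x : ℝ) t with h | h
    · have := mul_le_mul_of_nonneg_right h (abs_nonneg y)
      have := h_nonneg x
      show (x : ℝ) * |y| - H x ≤ _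
      linarith
    · have hx0 : (0 : ℝ) < x := ht.trans_le h
      have h1 : c ≤ H x / (x : ℝ) ^ 2 := h_mono ht hx0 h
      rw [le_div_iff₀ (by positivity)] at h1
      have h2 : (x : ℝ) * |y| - c * (x : ℝ) ^ 2 ≤ y ^ 2 / (4 * c) := by
        rw [le_div_iff₀ (by positivity), ← sq_abs y]
        nlinarith [sq_nonneg (2 * c * (x : ℝ) - |y|)]
      have h3 : 0 ≤ t * |y| := by positivity
      show (x : ℝ) * |y| - H x ≤ _
      linarith

/-! The proof is a Herbst argument for an inf-convolution. Take `B ⊂ A` compact, of measure close to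
at least 1/2, and let G(x) be the minimum of r and inf over y in B of ∑ H*(x_i - y_i). Then G
vanishes on B and equals r off the enlargement of B.

A nonzero partial derivative p of G is a subgradient of H* at some u. Monotonicity of H(x)/x²
dualizes to H*(au) ≤ a² H*(u) for a ≥ 1, whence pu ≤ 2H*(u); with Young's equality H(p) = pu - H*(u)
this gives H(p) ≤ H*(u). Summing, ∑ H(∂_i G) ≤ G (`sum_deriv_min_infConv_le`). The log-Sobolev
inequality for exp(sG/2) on coordinate lines, tensorized by `ent_pi_le`, becomes Ent(e^{sG}) ≤ b s²
∫ G e^{sG} for 0 < |s| ≤ 2k, with b = κ ω_H(k)/(2k)² independent of n.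

Integrating this for s > 0 and for s < 0 and eliminating ∫ G compares the Laplace transforms of G at
2k and -2k (`cgf_le_of_ent_le`). The latter is at least the mass of B, so Chernoff bounds the
missing mass q by exp(-2kr + (1+η)/(1-η) log 2), where η = 2kb < 1. Combining this with q ≤ 1/2
removes the prefactor and leaves exp(-(k - c ω_H(k)) r) with c = ω_H(2) κ. The supremum of these
rates over k is K. -/

/-! ### Conjugate function: growth and subgradients. -/

section Legendre

variable {H : ℝ → ℝ}

theorem legendre_zero (h_nonneg : ∀ x, 0 ≤ H x) (h_zero : H 0 = 0) : legendre H 0 = 0 := by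
  refine le_antisymm (ciSup_le fun x => by simpa using h_nonneg x) ?_
  refine le_ciSup_of_le (f := fun x : ℝ≥0 => (x : ℝ) * |(0 : ℝ)| - H x) ?_ 0 (by simp [h_zero])
  refine ⟨0, ?_⟩
  rintro _ ⟨x, rfl⟩
  simpa using h_nonneg x

theorem mul_sub_le_legendre (h_even : Function.Even H)
    (hb : ∀ y, BddAbove (range fun x : ℝ≥0 => (x : ℝ) * |y| - H x)) (x y : ℝ) :
    x * y - H x ≤ legendre H y := by
  have h1 : |x| * |y| - H |x| ≤ legendre H y := le_ciSup (hb y) (⟨|x|, abs_nonneg x⟩ : ℝ≥0)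
  have h2 : H |x| = H x := by
    rcases abs_choice x with h | h <;> rw [h]
    exact h_even x
  rw [h2, ← abs_mul] at h1
  linarith [le_abs_self (x * y)]

theorem legendre_nonneg (h_even : Function.Even H) (h_zero : H 0 = 0)
    (hb : ∀ y, BddAbove (range fun x : ℝ≥0 => (x : ℝ) * |y| - H x)) (y : ℝ) :
    0 ≤ legendre H y := by
  simpa [h_zero] using mul_sub_le_legendre h_even hb 0 y

theorem sq_mul_le_of_monotoneOn_div_sq (h_even : Function.Even H) (h_zero : H 0 = 0)
    (h_mono : MonotoneOn (fun x => H x / x ^ 2) (Ioi 0)) {a : ℝ} (ha : 1 ≤ a) (x : ℝ) :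
    a ^ 2 * H x ≤ H (a * x) := by
  have key : ∀ x : ℝ, 0 < x → a ^ 2 * H x ≤ H (a * x) := by
    intro x hx
    have h0 : 0 < a * x := by positivity
    have h1 : H x / x ^ 2 ≤ H (a * x) / (a * x) ^ 2 :=
      h_mono hx h0 (le_mul_of_one_le_left hx.le ha)
    rw [div_le_div_iff₀ (by positivity) (by positivity)] at h1
    have h2 : (a ^ 2 * H x) * x ^ 2 ≤ H (a * x) * x ^ 2 := by linarith
    exact le_of_mul_le_mul_right h2 (by positivity)
  rcases lt_trichotomy x 0 with hx | rfl | hx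
  · have := key (-x) (by linarith)
    rwa [mul_neg, h_even, h_even] at this
  · simp [h_zero]
  · exact key x hx

/-- Dual to the growth of `H`: compare x in the first supremum with x/a in the second, using H(x) ≥
a² H(x/a). -/
theorem legendre_mul_le (h_even : Function.Even H) (h_zero : H 0 = 0)
    (h_mono : MonotoneOn (fun x => H x / x ^ 2) (Ioi 0))
    (hb : ∀ y, BddAbove (range fun x : ℝ≥0 => (x : ℝ) * |y| - H x)) {a : ℝ} (ha : 1 ≤ a) (y : ℝ) :
    legendre H (a * y) ≤ a ^ 2 * legendre H y := by
  refine ciSup_le fun x => ?_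
  have ha0 : 0 < a := by linarith
  have h1 := sq_mul_le_of_monotoneOn_div_sq h_even h_zero h_mono ha (x / a)
  rw [mul_div_cancel₀ _ ha0.ne'] at h1
  have h2 := le_ciSup (hb y) (⟨x / a, by positivity⟩ : ℝ≥0)
  have h3 : (x : ℝ) / a * |y| - H (x / a) ≤ legendre H y := h2
  rw [abs_mul, abs_of_pos ha0]
  have h4 : a ^ 2 * ((x : ℝ) / a * |y| - H (x / a)) ≤ a ^ 2 * legendre H y := by gcongr
  have h5 : a ^ 2 * ((x : ℝ) / a * |y|) = x * (a * |y|) := by field_simp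
  linarith

/-- Young's equality, in the direction `H ≤ H**`, at a subgradient `p` of `H*`. -/
theorem le_mul_sub_legendre_of_subgradient (h_convex : ConvexOn ℝ univ H) {p u : ℝ}
    (hp : ∀ v, legendre H u + p * (v - u) ≤ legendre H v) (h_even : Function.Even H) :
    H p ≤ p * u - legendre H u := by
  refine le_of_forall_lt fun a ha => ?_
  obtain ⟨b, hab, hb⟩ := exists_between ha
  have hc : Continuous H := h_convex.locallyLipschitz.continuous
  -- An affine minorant of slope `v`, at or above `b` at `p`, gives H*(v) ≤ pv - b; the subgradient
  -- inequality at `v` then yields b ≤ pu - H*(u).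
  obtain ⟨v, c, h1, h2⟩ := h_convex.exists_affine_le_of_lt_real (mem_univ p) hb
    isClosed_univ (hc.lowerSemicontinuous.lowerSemicontinuousOn _)
  refine hab.trans_le ?_
  have h3 : legendre H v ≤ p * v - b := by
    refine ciSup_le fun x => ?_
    have hle : ∀ z : ℝ, v * z + c ≤ H z := fun z => h1 z (mem_univ z)
    rcases abs_choice v with h | h <;> rw [h]
    · have := hle x
      nlinarith
    · have := hle (-x)
      rw [h_even] at this
      nlinarith
  linarith [hp v]

/-- If `H x / x ^ 2` is non-decreasing, then `H p ≤ H* u` for every subgradient `p` of `H*`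
at `u`. -/
theorem le_legendre_of_subgradient (h_even : Function.Even H) (h_convex : ConvexOn ℝ univ H)
    (h_zero : H 0 = 0) (h_mono : MonotoneOn (fun x => H x / x ^ 2) (Ioi 0))
    (hb : ∀ y, BddAbove (range fun x : ℝ≥0 => (x : ℝ) * |y| - H x)) {p u : ℝ}
    (hp : ∀ v, legendre H u + p * (v - u) ≤ legendre H v) :
    H p ≤ legendre H u := by
  have h1 := le_mul_sub_legendre_of_subgradient h_convex hp h_even
  have h2 : p * u ≤ 2 * legendre H u := by
    refine le_of_forall_pos_le_add fun ε hε => ?_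
    set L := legendre H u with hL
    have hL0 : 0 ≤ L := legendre_nonneg h_even h_zero hb u
    -- Testing the subgradient at (1+s)u gives s·pu ≤ ((1+s)² - 1)L = s(2 + s)L; this `s` makes sL ≤
    -- ε.
    set s := ε / (L + 1) with hs
    have hs0 : 0 < s := by positivity
    have h3 := hp ((1 + s) * u)
    have h4 := legendre_mul_le h_even h_zero h_mono hb (a := 1 + s) (by linarith) u
    rw [← hL] at h4
    have h5 : s * (p * u) ≤ s * (2 * L + s * L) := by nlinarith
    have h6 := le_of_mul_le_mul_left h5 hs0
    have h7 : s * L ≤ ε := by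
      rw [hs, div_mul_eq_mul_div, div_le_iff₀ (by linarith)]
      nlinarith
    linarith
  linarith

end Legendre

/-! ### Inf-convolution and its Hamilton-Jacobi bound. -/

section InfConv

open Filter Topology

/-- The inf-convolution `x ↦ inf_{y ∈ A} ∑ i, L (x i - y i)` of the indicator of `A` with the
separable cost given by `L`. -/
noncomputable def infConv {n : ℕ} (L : ℝ → ℝ) (A : Set (Fin n → ℝ)) (x : Fin n → ℝ) : ℝ :=
  sInf ((fun y => ∑ i, L (x i - y i)) '' A)

variable {n : ℕ} {L : ℝ → ℝ} {A : Set (Fin n → ℝ)}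

theorem continuous_infConv (hL : Continuous L) (hA : IsCompact A) :
    Continuous (infConv L A) :=
  hA.continuous_sInf (f := fun x y : Fin n → ℝ => ∑ i, L (x i - y i)) (by
    unfold Function.HasUncurry.uncurry Function.hasUncurryInduction
    simp only [Function.HasUncurry.uncurry, id]
    fun_prop)

theorem exists_infConv_eq (hL : Continuous L) (hA : IsCompact A) (hne : A.Nonempty)
    (x : Fin n → ℝ) : ∃ y ∈ A, infConv L A x = ∑ i, L (x i - y i) :=
  hA.exists_sInf_image_eq hne (by fun_prop)

theorem infConv_le (h0 : ∀ u, 0 ≤ L u) {y : Fin n → ℝ} (hy : y ∈ A) (x : Fin n → ℝ) :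
    infConv L A x ≤ ∑ i, L (x i - y i) := by
  refine csInf_le ⟨0, ?_⟩ (mem_image_of_mem _ hy)
  rintro _ ⟨z, -, rfl⟩
  exact Finset.sum_nonneg fun i _ => h0 _

theorem infConv_nonneg (h0 : ∀ u, 0 ≤ L u) (x : Fin n → ℝ) : 0 ≤ infConv L A x := by
  refine Real.sInf_nonneg ?_
  rintro _ ⟨z, -, rfl⟩
  exact Finset.sum_nonneg fun i _ => h0 _

theorem infConv_eq_zero (h0 : ∀ u, 0 ≤ L u) (hL0 : L 0 = 0) {x : Fin n → ℝ} (hx : x ∈ A) :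
    infConv L A x = 0 :=
  le_antisymm ((infConv_le h0 hx x).trans (by simp [hL0])) (infConv_nonneg h0 x)

theorem sum_update_sub (x y : Fin n → ℝ) (i : Fin n) (t : ℝ) :
    ∑ j, L (Function.update x i t j - y j) =
      ∑ j, L (x j - y j) + (L (t - y i) - L (x i - y i)) := by
  rw [← sub_eq_iff_eq_add', ← Finset.sum_sub_distrib, Finset.sum_eq_single i]
  · simp
  · intro j _ hj
    simp [Function.update_of_ne hj]
  · simp

/-- For t near t₀ and y in the compact set `A`, all differences t - y_i lie in one compact interval,
on which `L` is Lipschitz. The minimizer for t serves as competitor for s. -/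
theorem locallyLipschitz_infConv_update (hL : LocallyLipschitz L) (h0 : ∀ u, 0 ≤ L u)
    (hA : IsCompact A) (hne : A.Nonempty) (x : Fin n → ℝ) (i : Fin n) :
    LocallyLipschitz fun t => infConv L A (Function.update x i t) := by
  intro t₀
  obtain ⟨R, hR⟩ := (hA.image (continuous_apply i)).isBounded.subset_closedBall (0 : ℝ)
  obtain ⟨K, hK⟩ := LocallyLipschitzOn.exists_lipschitzOnWith_of_compact
    (isCompact_Icc (a := t₀ - 1 - R) (b := t₀ + 1 + R)) hL.locallyLipschitzOn
  refine ⟨K, Icc (t₀ - 1) (t₀ + 1), Icc_mem_nhds (by linarith) (by linarith), ?_⟩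
  have hmem : ∀ y ∈ A, ∀ t ∈ Icc (t₀ - 1) (t₀ + 1),
      t - y i ∈ Icc (t₀ - 1 - R) (t₀ + 1 + R) := by
    intro y hy t ht
    have h1 := hR (mem_image_of_mem _ hy)
    rw [Metric.mem_closedBall, dist_zero_right, Real.norm_eq_abs, abs_le] at h1
    exact ⟨by linarith [ht.1, h1.2], by linarith [ht.2, h1.1]⟩
  refine LipschitzOnWith.of_le_add_mul K fun s hs t ht => ?_
  obtain ⟨y, hy, hyt⟩ := exists_infConv_eq hL.continuous hA hne (Function.update x i t)
  have h1 := infConv_le h0 hy (Function.update x i s)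
  rw [hyt]
  rw [sum_update_sub] at h1 ⊢
  have h2 := hK.le_add_mul (hmem y hy s hs) (hmem y hy t ht)
  rw [dist_sub_right] at h2
  linarith

/-- A function touching a convex function from below has a subgradient as derivative. -/
theorem subgradient_of_hasDerivAt (hL : ConvexOn ℝ univ L) {g : ℝ → ℝ} {t₀ u p : ℝ}
    (hg : HasDerivAt g p t₀) (hle : ∀ t, g t ≤ g t₀ + (L (u + (t - t₀)) - L u)) (v : ℝ) :
    L u + p * (v - u) ≤ L v := by
  have h1 : HasDerivAt (fun s : ℝ => g (t₀ + s * (v - u))) (p * (v - u)) 0 := by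
    have h2 : HasDerivAt (fun s : ℝ => t₀ + s * (v - u)) (v - u) 0 := by
      simpa using ((hasDerivAt_id (0 : ℝ)).mul_const (v - u)).const_add t₀
    have h3 : HasDerivAt g p (t₀ + 0 * (v - u)) := by simpa using hg
    exact h3.comp (0 : ℝ) h2
  have h4 : p * (v - u) ≤ L v - L u := by
    refine le_of_tendsto h1.tendsto_slope_zero_right ?_
    filter_upwards [Ioo_mem_nhdsGT (zero_lt_one' ℝ)] with s hs
    have h5 := hle (t₀ + s * (v - u))
    have h6 := hL.2 (mem_univ u) (mem_univ v) (sub_nonneg.2 hs.2.le) hs.1.le (by ring)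
    simp only [smul_eq_mul] at h6
    have h7 : (1 - s) * u + s * v = u + (t₀ + s * (v - u) - t₀) := by ring
    rw [h7] at h6
    simp only [zero_add, zero_mul, add_zero, smul_eq_mul]
    rw [inv_mul_le_iff₀ hs.1]
    linarith
  linarith

variable {H : ℝ → ℝ}

/-- The Hamilton-Jacobi type bound `∑ i, H (∂ᵢ G) ≤ G` for the truncation
`G = min (infConv L A) r`, if `H p ≤ L u` for all subgradients `p` of `L` at `u`. -/
theorem sum_deriv_min_infConv_le (hL : ConvexOn ℝ univ L) (h0 : ∀ u, 0 ≤ L u) (hH0 : H 0 = 0)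
    (hHL : ∀ p u, (∀ v, L u + p * (v - u) ≤ L v) → H p ≤ L u)
    (hA : IsCompact A) (hne : A.Nonempty) {r : ℝ} (hr : 0 ≤ r) (x : Fin n → ℝ) :
    ∑ i, H (deriv (fun t => min (infConv L A (Function.update x i t)) r) (x i)) ≤
      min (infConv L A x) r := by
  rcases le_total (infConv L A x) r with hx | hx
  · rw [min_eq_left hx]
    obtain ⟨y, hy, hxy⟩ := exists_infConv_eq hL.locallyLipschitz.continuous hA hne x
    rw [hxy]
    refine Finset.sum_le_sum fun i _ => ?_
    by_cases hd : DifferentiableAt ℝ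
        (fun t => min (infConv L A (Function.update x i t)) r) (x i)
    -- With the minimizer `y` for `x` frozen, the cost touches the truncated infimum from above at
    -- `x`, so the partial derivative is a subgradient at x_i - y_i.
    · refine hHL _ _ (subgradient_of_hasDerivAt hL hd.hasDerivAt fun t => ?_)
      refine (min_le_left _ _).trans ?_
      rw [Function.update_eq_self, min_eq_left hx, hxy]
      refine (infConv_le h0 hy _).trans_eq ?_
      rw [sum_update_sub]
      ring_nf
    · rw [deriv_zero_of_not_differentiableAt hd, hH0]
      exact h0 _
  · rw [min_eq_right hx]
    refine (Finset.sum_eq_zero fun i _ => ?_).trans_le hr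
    -- At or above level `r` the truncation attains its maximum, so the derivative vanishes.
    have : IsLocalMax (fun t => min (infConv L A (Function.update x i t)) r) (x i) := by
      refine Eventually.of_forall fun t => ?_
      dsimp only
      rw [Function.update_eq_self, min_eq_right hx]
      exact min_le_right _ _
    rw [this.deriv_eq_zero, hH0]

end InfConv

/-! ### Entropy: variational inequality and tensorization. -/

section Ent

/-- The entropy of a function on an arbitrary measure space. -/
noncomputable def ent {Ω : Type*} [MeasurableSpace Ω] (μ : Measure Ω) (g : Ω → ℝ) : ℝ :=
  ∫ x, g x * Real.log (g x) ∂μ - (∫ x, g x ∂μ) * Real.log (∫ x, g x ∂μ)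

variable {Ω Ω' : Type*} [MeasurableSpace Ω] [MeasurableSpace Ω']

theorem integrable_of_mem_Icc {μ : Measure Ω} [IsFiniteMeasure μ] {g : Ω → ℝ} {c C : ℝ}
    (hg : Measurable g) (hgc : ∀ x, g x ∈ Icc c C) : Integrable g μ :=
  Integrable.of_mem_Icc c C hg.aemeasurable (ae_of_all _ hgc)

theorem integral_mem_Icc {μ : Measure Ω} [IsProbabilityMeasure μ] {g : Ω → ℝ} {c C : ℝ}
    (hg : Measurable g) (hgc : ∀ x, g x ∈ Icc c C) : ∫ x, g x ∂μ ∈ Icc c C := by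
  have hi := integrable_of_mem_Icc (μ := μ) hg hgc
  constructor
  · simpa using integral_mono (integrable_const c) hi fun x => (hgc x).1
  · simpa using integral_mono hi (integrable_const C) fun x => (hgc x).2

theorem exists_mul_log_mem_Icc {c C : ℝ} :
    ∃ M, ∀ t ∈ Icc c C, t * Real.log t ∈ Icc (-M) M := by
  obtain ⟨M, hM⟩ := (isCompact_Icc (a := c) (b := C)).exists_bound_of_continuousOn
    Real.continuous_mul_log.continuousOn
  exact ⟨M, fun t ht => abs_le.1 (hM t ht)⟩

theorem integrable_mul_log {μ : Measure Ω} [IsFiniteMeasure μ] {g : Ω → ℝ} {c C : ℝ}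
    (hg : Measurable g) (hgc : ∀ x, g x ∈ Icc c C) :
    Integrable (fun x => g x * Real.log (g x)) μ := by
  obtain ⟨M, hM⟩ := exists_mul_log_mem_Icc (c := c) (C := C)
  exact integrable_of_mem_Icc (hg.mul hg.log) fun x => hM _ (hgc x)

/-- The Gibbs variational inequality for the entropy. -/
theorem integral_mul_log_le_ent {μ : Measure Ω} [IsProbabilityMeasure μ] {g h : Ω → ℝ}
    {c C : ℝ} (hc : 0 < c) (hg : Measurable g) (hgc : ∀ x, g x ∈ Icc c C)
    (hh : ∀ x, 0 < h x) (hhi : Integrable h μ) (h1 : ∫ x, h x ∂μ = 1)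
    (hgh : Integrable (fun x => g x * Real.log (h x)) μ) :
    ∫ x, g x * Real.log (h x) ∂μ ≤ ent μ g := by
  have hgi := integrable_of_mem_Icc (μ := μ) hg hgc
  have hgl := integrable_mul_log (μ := μ) hg hgc
  set m := ∫ x, g x ∂μ with hm
  have hm0 : 0 < m := hc.trans_le (integral_mem_Icc hg hgc).1
  have key : ∀ x, g x * Real.log (h x) ≤
      (g x * Real.log (g x) - g x * Real.log m) + (m * h x - g x) := by
    intro x
    have hgx : 0 < g x := hc.trans_le (hgc x).1
    have h2 := Real.log_le_sub_one_of_pos (x := m * h x / g x)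
      (div_pos (mul_pos hm0 (hh x)) hgx)
    rw [Real.log_div (mul_pos hm0 (hh x)).ne' hgx.ne', Real.log_mul hm0.ne' (hh x).ne'] at h2
    have h3 := mul_le_mul_of_nonneg_left h2 hgx.le
    have h4 : g x * (m * h x / g x - 1) = m * h x - g x := by field_simp
    linarith
  have hi1 : Integrable (fun x => g x * Real.log (g x) - g x * Real.log m) μ :=
    hgl.sub (hgi.mul_const _)
  have hi2 : Integrable (fun x => m * h x - g x) μ := (hhi.const_mul m).sub hgi
  have h5 := integral_mono hgh (hi1.add hi2) key
  have h6 : ∫ x, ((fun x => g x * Real.log (g x) - g x * Real.log m) +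
      (fun x => m * h x - g x)) x ∂μ = ent μ g := by
    rw [integral_add' hi1 hi2, integral_sub hgl (hgi.mul_const _),
      integral_sub (hhi.const_mul m) hgi, integral_mul_const, integral_const_mul, h1, ← hm, ent,
      ← hm]
    ring
  exact h5.trans_eq h6

/-- Subadditivity of the entropy on a product of two spaces. -/
theorem ent_prod_le (μ : Measure Ω) [IsProbabilityMeasure μ] (ν : Measure Ω')
    [IsProbabilityMeasure ν] {g : Ω × Ω' → ℝ} {c C : ℝ} (hc : 0 < c) (hg : Measurable g)
    (hgc : ∀ x, g x ∈ Icc c C) :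
    ent (μ.prod ν) g ≤
      ∫ y, ent μ (fun x => g (x, y)) ∂ν + ∫ x, ent ν (fun y => g (x, y)) ∂μ := by
  have hgi := integrable_of_mem_Icc (μ := μ.prod ν) hg hgc
  have hgl := integrable_mul_log (μ := μ.prod ν) hg hgc
  have hsec1 : ∀ y, Measurable fun x => g (x, y) := fun y => hg.comp measurable_prodMk_right
  have hsec2 : ∀ x, Measurable fun y => g (x, y) := fun x => hg.comp measurable_prodMk_left
  set G : Ω' → ℝ := fun y => ∫ x, g (x, y) ∂μ with hG
  have hGm : Measurable G := (hg.stronglyMeasurable.integral_prod_left' (μ := μ)).measurable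
  have hGc : ∀ y, G y ∈ Icc c C := fun y => integral_mem_Icc (hsec1 y) fun x => hgc _
  have hG0 : ∀ y, 0 < G y := fun y => hc.trans_le (hGc y).1
  have hGi := integrable_of_mem_Icc (μ := ν) hGm hGc
  have hGl := integrable_mul_log (μ := ν) hGm hGc
  set m := ∫ y, G y ∂ν with hm
  have hm0 : 0 < m := hc.trans_le (integral_mem_Icc hGm hGc).1
  have hmg : ∫ p, g p ∂(μ.prod ν) = m := integral_prod_symm _ hgi
  have hC : 0 < C := by
    obtain ⟨y⟩ : Nonempty Ω' := nonempty_of_isProbabilityMeasure ν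
    exact (hG0 y).trans_le (hGc y).2
  have hlog : Measurable fun y => Real.log (G y / m) := (hGm.div_const m).log
  have hlogb : ∀ y, |Real.log (G y / m)| ≤ max |Real.log (c / m)| |Real.log (C / m)| := by
    intro y
    refine abs_le_max_abs_abs ?_ ?_
    · exact Real.log_le_log (by positivity) (by gcongr; exact (hGc y).1)
    · exact Real.log_le_log (div_pos (hG0 y) hm0) (by gcongr; exact (hGc y).2)
  have hgφ : Integrable (fun p : Ω × Ω' => g p * Real.log (G p.2 / m)) (μ.prod ν) :=
    hgi.mul_bdd (hlog.comp measurable_snd).aestronglyMeasurable (ae_of_all _ fun p => hlogb p.2)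
  have hgφ2 : ∀ x, Integrable (fun y => g (x, y) * Real.log (G y / m)) ν := fun x =>
    (integrable_of_mem_Icc (hsec2 x) fun y => hgc _).mul_bdd hlog.aestronglyMeasurable
      (ae_of_all _ hlogb)
  -- Gibbs on each fibre with the same test density, the normalized marginal G/m. Averaged over x,
  -- the left side becomes the entropy of `G`, which is what the chain rule `h4` leaves to be
  -- bounded.
  have h1 : ∀ x, ∫ y, g (x, y) * Real.log (G y / m) ∂ν ≤ ent ν (fun y => g (x, y)) := by
    intro x
    refine integral_mul_log_le_ent hc (hsec2 x) (fun y => hgc _) (fun y => div_pos (hG0 y) hm0)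
      (hGi.div_const m) ?_ (hgφ2 x)
    rw [integral_div, ← hm, div_self hm0.ne']
  have hM : ∀ x, ∫ y, g (x, y) ∂ν ∈ Icc c C := fun x => integral_mem_Icc (hsec2 x) fun y => hgc _
  have hMm : Measurable fun x => ∫ y, g (x, y) ∂ν :=
    (hg.stronglyMeasurable.integral_prod_right' (ν := ν)).measurable
  have hent : Integrable (fun x => ent ν (fun y => g (x, y))) μ :=
    hgl.integral_prod_left.sub (integrable_mul_log hMm hM)
  have h2 := integral_mono hgφ.integral_prod_left hent h1
  have h3 : ∫ x, ∫ y, g (x, y) * Real.log (G y / m) ∂ν ∂μ =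
      ∫ y, G y * Real.log (G y) ∂ν - m * Real.log m := by
    rw [← integral_prod _ hgφ, integral_prod_symm _ hgφ]
    have : ∀ y, ∫ x, g (x, y) * Real.log (G y / m) ∂μ =
        G y * Real.log (G y) - G y * Real.log m := by
      intro y
      rw [integral_mul_const, Real.log_div (hG0 y).ne' hm0.ne', mul_sub]
    simp_rw [this]
    rw [integral_sub hGl (hGi.mul_const _), integral_mul_const]
  have h4 : ∫ y, ent μ (fun x => g (x, y)) ∂ν =
      ∫ p, g p * Real.log (g p) ∂(μ.prod ν) - ∫ y, G y * Real.log (G y) ∂ν := by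
    unfold ent
    rw [integral_sub hgl.integral_prod_right hGl, integral_prod_symm _ hgl]
  rw [ent, hmg, h4]
  simp only at h2
  linarith

theorem ent_map {μ : Measure Ω} {ν : Measure Ω'} {e : Ω ≃ᵐ Ω'} (he : MeasurePreserving e μ ν)
    (g : Ω → ℝ) : ent μ g = ent ν (g ∘ e.symm) := by
  have h : ∀ f : Ω → ℝ, ∫ x, f x ∂μ = ∫ y, f (e.symm y) ∂ν := fun f => by
    rw [← he.integral_comp']
    simp
  simp [ent, h]

/-- Tensorization of the entropy: bounds on the entropy in each coordinate add up. -/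
theorem ent_pi_le (μ : Measure Ω) [IsProbabilityMeasure μ] {c C B : ℝ} (hc : 0 < c) :
    ∀ (n : ℕ) (g : (Fin n → Ω) → ℝ) (h : Fin n → (Fin n → Ω) → ℝ), Measurable g →
      (∀ x, g x ∈ Icc c C) → (∀ i, Measurable (h i)) → (∀ i x, h i x ∈ Icc 0 B) →
      (∀ i x, ent μ (fun t => g (Function.update x i t)) ≤
        ∫ t, h i (Function.update x i t) ∂μ) →
      ent (Measure.pi fun _ : Fin n => μ) g ≤
        ∫ x, ∑ i, h i x ∂(Measure.pi fun _ : Fin n => μ) := by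
  intro n
  induction n with
  | zero =>
    intro g h _ _ _ _ _
    have : ent (Measure.pi fun _ : Fin 0 => μ) g = 0 := by
      have hg : g = fun _ => g default := funext fun x => by rw [Subsingleton.elim x default]
      rw [hg]
      simp [ent]
    simp [this]
  | succ n ih =>
    intro g h hg hgc hh hhB hle
    set P := Measure.pi fun _ : Fin n => μ with hP
    have he := measurePreserving_piFinSuccAbove (fun _ : Fin (n + 1) => μ) 0
    set e := MeasurableEquiv.piFinSuccAbove (fun _ : Fin (n + 1) => Ω) 0 with hedef
    have hes : ∀ (t : Ω) (y : Fin n → Ω), e.symm (t, y) = Fin.cons t y := by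
      intro t y
      simp [hedef, MeasurableEquiv.piFinSuccAbove, Fin.consEquiv]
    have hi : ∀ i, Integrable (fun p => h i (e.symm p)) (μ.prod P) := fun i =>
      integrable_of_mem_Icc ((hh i).comp e.symm.measurable) fun p => hhB i _
    have hi' : ∀ i, Integrable (fun x => h i x) (Measure.pi fun _ : Fin (n + 1) => μ) := fun i =>
      integrable_of_mem_Icc (hh i) (hhB i)
    have hint : ∀ f : (Fin (n + 1) → Ω) → ℝ, ∫ x, f x ∂(Measure.pi fun _ : Fin (n + 1) => μ) =
        ∫ p, f (e.symm p) ∂(μ.prod P) := fun f => by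
      rw [← he.integral_comp']
      simp
    have hg' : Measurable (g ∘ e.symm) := hg.comp e.symm.measurable
    rw [ent_map he, integral_finsetSum _ fun i _ => hi' i, Fin.sum_univ_succ]
    refine (ent_prod_le μ P hc hg' fun p => hgc _).trans ?_
    have hgl := integrable_mul_log (μ := μ.prod P) hg' fun p => hgc _
    refine add_le_add ?_ ?_
    · rw [hint, integral_prod_symm _ (hi 0)]
      refine integral_mono ?_ (hi 0).integral_prod_right fun y => ?_
      · refine hgl.integral_prod_right.sub (integrable_mul_log ?_ fun y =>
          integral_mem_Icc (c := c) (C := C) (hg'.comp measurable_prodMk_right) fun x => hgc _)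
        exact (hg'.stronglyMeasurable.integral_prod_left' (μ := μ)).measurable
      · obtain ⟨a⟩ : Nonempty Ω := nonempty_of_isProbabilityMeasure μ
        have := hle 0 (Fin.cons a y)
        simpa only [Function.comp, hes, Fin.update_cons_zero] using this
    · have h1 : ∀ x, ent P (fun y => (g ∘ e.symm) (x, y)) ≤
          ∫ y, ∑ i : Fin n, h i.succ (e.symm (x, y)) ∂P := by
        intro x
        refine ih _ (fun i y => h i.succ (e.symm (x, y))) (hg'.comp measurable_prodMk_left)
          (fun y => hgc _) (fun i => ((hh _).comp e.symm.measurable).comp measurable_prodMk_left)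
          (fun i y => hhB _ _) fun i y => ?_
        have := hle i.succ (Fin.cons x y)
        simpa only [Function.comp, hes, Fin.cons_update] using this
      have h2 : Integrable (fun p => ∑ i : Fin n, h i.succ (e.symm p)) (μ.prod P) :=
        integrable_finsetSum _ fun i _ => hi i.succ
      calc ∫ x, ent P (fun y => (g ∘ e.symm) (x, y)) ∂μ
          ≤ ∫ x, ∫ y, ∑ i : Fin n, h i.succ (e.symm (x, y)) ∂P ∂μ := by
            refine integral_mono ?_ h2.integral_prod_left h1
            refine hgl.integral_prod_left.sub (integrable_mul_log ?_ fun y =>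
              integral_mem_Icc (c := c) (C := C) (hg'.comp measurable_prodMk_left) fun x => hgc _)
            exact (hg'.stronglyMeasurable.integral_prod_right' (ν := P)).measurable
        _ = ∑ i : Fin n, ∫ x, h i.succ x ∂(Measure.pi fun _ : Fin (n + 1) => μ) := by
            rw [← integral_prod _ h2, integral_finsetSum _ fun i _ => hi i.succ]
            exact Finset.sum_congr rfl fun i _ => (hint _).symm

end Ent

/-! ### The two-sided Herbst argument. -/

section Herbst

open ProbabilityTheory Filter Topology

/-- The derivative of ψ(s)(1/s - b) is ((s - bs²)ψ'(s) - ψ(s))/s² ≤ 0, and the limit at 0+ is ψ'(0)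
because ψ(0) = 0. -/
theorem mul_inv_sub_le_of_deriv_bound {ψ ψ' : ℝ → ℝ} {b k : ℝ} (hψ : ∀ s, HasDerivAt ψ (ψ' s) s)
    (h0 : ψ 0 = 0) (hk : 0 < k) (h : ∀ s ∈ Ioo 0 k, (s - b * s ^ 2) * ψ' s ≤ ψ s) :
    ψ k * (k⁻¹ - b) ≤ ψ' 0 := by
  have hw : ∀ s, s ≠ 0 → HasDerivAt (fun s => ψ s * (s⁻¹ - b))
      (ψ' s * (s⁻¹ - b) + ψ s * (-(s ^ 2)⁻¹)) s := fun s hs =>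
    (hψ s).mul ((hasDerivAt_inv hs).sub_const b)
  have hanti : AntitoneOn (fun s => ψ s * (s⁻¹ - b)) (Ioc 0 k) := by
    refine antitoneOn_of_deriv_nonpos (convex_Ioc 0 k)
      (fun s hs => (hw s hs.1.ne').continuousAt.continuousWithinAt) ?_ ?_
    · rw [interior_Ioc]
      exact fun s hs => (hw s hs.1.ne').differentiableAt.differentiableWithinAt
    · rw [interior_Ioc]
      intro s hs
      rw [(hw s hs.1.ne').deriv]
      have hs0 := hs.1
      have h1 : ψ' s * (s⁻¹ - b) + ψ s * (-(s ^ 2)⁻¹) =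
          ((s - b * s ^ 2) * ψ' s - ψ s) / s ^ 2 := by
        field_simp
        ring
      rw [h1]
      exact div_nonpos_of_nonpos_of_nonneg (by linarith [h s hs]) (by positivity)
  have hlim : Tendsto (fun s => ψ s * (s⁻¹ - b)) (𝓝[>] 0) (𝓝 (ψ' 0)) := by
    have h1 := (hψ 0).tendsto_slope_zero_right
    have h2 : Tendsto (fun s => ψ s * b) (𝓝[>] 0) (𝓝 0) := by
      have := ((hψ 0).continuousAt.mul_const b).tendsto
      rw [h0, zero_mul] at this
      exact this.mono_left nhdsWithin_le_nhds
    have h3 := h1.sub h2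
    rw [sub_zero] at h3
    refine h3.congr fun s => ?_
    simp only [zero_add, h0, sub_zero, smul_eq_mul]
    ring
  refine ge_of_tendsto hlim ?_
  filter_upwards [Ioc_mem_nhdsGT hk] with s hs
  exact hanti hs (right_mem_Ioc.2 hk) hs.2

variable {Ω : Type*} [MeasurableSpace Ω] {P : Measure Ω} [IsProbabilityMeasure P] {X : Ω → ℝ}
  {r : ℝ}

theorem integrable_exp_mul_of_mem_Icc (hX : Measurable X) (hXr : ∀ x, X x ∈ Icc 0 r) (s : ℝ) :
    Integrable (fun x => Real.exp (s * X x)) P := by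
  refine integrable_of_mem_Icc (c := 0) (C := Real.exp (|s| * r)) (by fun_prop)
    fun x => ⟨by positivity, Real.exp_le_exp.2 ?_⟩
  exact (mul_le_mul_of_nonneg_right (le_abs_self s) (hXr x).1).trans
    (mul_le_mul_of_nonneg_left (hXr x).2 (abs_nonneg s))

theorem hasDerivAt_cgf_of_mem_Icc (hX : Measurable X) (hXr : ∀ x, X x ∈ Icc 0 r) (s : ℝ) :
    HasDerivAt (cgf X P) ((∫ x, X x * Real.exp (s * X x) ∂P) / mgf X P s) s := by
  have hi : integrableExpSet X P = univ :=
    eq_univ_of_forall fun s => integrable_exp_mul_of_mem_Icc hX hXr s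
  have hs : s ∈ interior (integrableExpSet X P) := by simp [hi]
  rw [← deriv_cgf hs]
  exact (analyticAt_cgf hs).differentiableAt.hasDerivAt

theorem ent_exp_mul (P : Measure Ω) (X : Ω → ℝ) (s : ℝ) :
    ent P (fun x => Real.exp (s * X x)) =
      s * ∫ x, X x * Real.exp (s * X x) ∂P - mgf X P s * cgf X P s := by
  rw [ent, cgf, mgf, ← integral_const_mul]
  congr 2
  ext x
  rw [Real.log_exp]
  ring

/-- The Herbst argument on both sides of the origin. -/
theorem cgf_le_of_ent_le (hX : Measurable X) (hXr : ∀ x, X x ∈ Icc 0 r) {b k : ℝ}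
    (hk : 0 < k)
    (hent : ∀ s, |s| ≤ k → s ≠ 0 → ent P (fun x => Real.exp (s * X x)) ≤
      b * s ^ 2 * ∫ x, X x * Real.exp (s * X x) ∂P) :
    (1 - b * k) * cgf X P k ≤ -((1 + b * k) * cgf X P (-k)) := by
  set ψ := cgf X P with hψdef
  set ψ' : ℝ → ℝ := fun s => (∫ x, X x * Real.exp (s * X x) ∂P) / mgf X P s with hψ'
  have hd : ∀ s, HasDerivAt ψ (ψ' s) s := hasDerivAt_cgf_of_mem_Icc hX hXr
  have h0 : ψ 0 = 0 := cgf_zero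
  have key : ∀ s, |s| ≤ k → s ≠ 0 → (s - b * s ^ 2) * ψ' s ≤ ψ s := by
    intro s hs hs0
    have h1 := hent s hs hs0
    have hZ : 0 < mgf X P s := mgf_pos (integrable_exp_mul_of_mem_Icc hX hXr s)
    rw [ent_exp_mul, ← hψdef] at h1
    rw [hψ']
    dsimp only
    rw [← mul_div_assoc, div_le_iff₀ hZ]
    linarith
  have h1 := mul_inv_sub_le_of_deriv_bound hd h0 hk fun s hs =>
    key s (by rw [abs_of_pos hs.1]; exact hs.2.le) hs.1.ne'
  have hd2 : ∀ s, HasDerivAt (fun s => ψ (-s)) (-ψ' (-s)) s := fun s => by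
    simpa [Function.comp_def] using (hd (-s)).comp s (hasDerivAt_neg s)
  -- Reflection changes the sign of s but not of bs², hence `-b`. The endpoint slopes ψ'(0) and
  -- -ψ'(0) cancel when the two bounds are added.
  have h2 := mul_inv_sub_le_of_deriv_bound (b := -b) hd2 (by simpa using h0) hk fun s hs => by
    have := key (-s) (by rw [abs_neg, abs_of_pos hs.1]; exact hs.2.le) (neg_ne_zero.2 hs.1.ne')
    rw [neg_sq] at this
    linarith
  rw [neg_zero] at h2
  have h3 : ψ k * (k⁻¹ - b) ≤ -(ψ (-k) * (k⁻¹ - -b)) := by linarith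
  have h4 := mul_le_mul_of_nonneg_left h3 hk.le
  have h5 : k * (ψ k * (k⁻¹ - b)) = (1 - b * k) * ψ k := by field_simp
  have h6 : k * -(ψ (-k) * (k⁻¹ - -b)) = -((1 + b * k) * ψ (-k)) := by field_simp; ring
  linarith

/-- Tail estimate for a bounded nonnegative variable that satisfies a self-bounded entropy
inequality, in terms of the mass of a set where the variable vanishes. -/
theorem measureReal_ge_le_of_ent_le (hX : Measurable X) (hXr : ∀ x, X x ∈ Icc 0 r) {b k : ℝ}
    (hb : 0 ≤ b) (hk : 0 < k) (hbk : b * k < 1)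
    (hent : ∀ s, |s| ≤ k → s ≠ 0 → ent P (fun x => Real.exp (s * X x)) ≤
      b * s ^ 2 * ∫ x, X x * Real.exp (s * X x) ∂P)
    {A : Set Ω} (hA : MeasurableSet A) (hXA : ∀ x ∈ A, X x = 0) (hPA : 0 < P.real A) :
    P.real {x | r ≤ X x} ≤
      Real.exp (-k * r + (1 + b * k) / (1 - b * k) * -Real.log (P.real A)) := by
  refine (measure_ge_le_exp_cgf r hk.le (integrable_exp_mul_of_mem_Icc hX hXr k)).trans
    (Real.exp_le_exp.2 ?_)
  have h1 := cgf_le_of_ent_le hX hXr hk hent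
  have hi := integrable_exp_mul_of_mem_Icc (P := P) hX hXr (-k)
  have h2 : Real.log (P.real A) ≤ cgf X P (-k) := by
    refine Real.log_le_log hPA ?_
    rw [mgf, ← integral_indicator_one hA]
    refine integral_mono ((integrable_const 1).indicator hA) hi fun x => ?_
    by_cases hx : x ∈ A
    · simp [hx, hXA x hx]
    · simpa [hx] using (Real.exp_pos _).le
  have h3 : cgf X P k ≤ (1 + b * k) / (1 - b * k) * -Real.log (P.real A) := by
    rw [div_mul_eq_mul_div, le_div_iff₀ (by linarith)]
    have : 0 ≤ b * k := by positivity
    nlinarith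
  linarith

end Herbst

/-! ### From the log-Sobolev inequality to exponential entropy bounds. -/

section ModifiedLogSobolev

variable {H : ℝ → ℝ}

/-- The test function is f = exp(sγ/2), for which f² = exp(sγ) and f'/f = sγ'/2; `β` absorbs both κ
and the factor s/2. -/
theorem ent_exp_mul_le_of_modifiedLogSobolev {μ : Measure ℝ} [IsProbabilityMeasure μ]
    (h_nonneg : ∀ x, 0 ≤ H x) (hHc : Continuous H) (h_zero : H 0 = 0) {κ : ℝ≥0}
    (h_mls : ModifiedLogSobolev μ H κ) {s β r : ℝ} (hs : s ≠ 0) (hβ0 : 0 ≤ β)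
    (hβ : ∀ p, κ * H (s / 2 * p) ≤ β * H p) {γ : ℝ → ℝ} (hγ : LocallyLipschitz γ)
    (hγr : ∀ t, γ t ∈ Icc 0 r) (hγH : ∀ t, H (deriv γ t) ≤ r) :
    ent μ (fun t => Real.exp (s * γ t)) ≤
      ∫ t, β * (H (deriv γ t) * Real.exp (s * γ t)) ∂μ := by
  have hγc : Continuous γ := hγ.continuous
  set f : ℝ → ℝ := fun t => Real.exp (s / 2 * γ t) with hf
  have hf2 : ∀ t, f t ^ 2 = Real.exp (s * γ t) := fun t => by
    rw [hf, ← Real.exp_nat_mul]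
    congr 1
    push_cast
    ring
  have hexp : ∀ t, Real.exp (s * γ t) ∈ Icc 0 (Real.exp (|s| * r)) := fun t =>
    ⟨by positivity, Real.exp_le_exp.2
      ((mul_le_mul_of_nonneg_right (le_abs_self s) (hγr t).1).trans
        (mul_le_mul_of_nonneg_left (hγr t).2 (abs_nonneg s)))⟩
  have hem : Measurable fun t => Real.exp (s * γ t) := by fun_prop
  have hfl : LocallyLipschitz f := by
    have h1 : LocallyLipschitz fun x : ℝ => Real.exp (s / 2 * x) := by
      have : ContDiff ℝ 1 fun x : ℝ => Real.exp (s / 2 * x) := by fun_prop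
      exact this.locallyLipschitz
    exact h1.comp hγ
  have h1 := h_mls f hfl (by simp_rw [hf2]; exact integrable_of_mem_Icc hem hexp)
    (by simp_rw [hf2]; exact integrable_mul_log hem hexp)
  have hderiv : ∀ t, κ * H (deriv f t / f t) ≤ β * H (deriv γ t) := by
    intro t
    have hft : f t ≠ 0 := (Real.exp_pos _).ne'
    by_cases hd : DifferentiableAt ℝ f t
    · have hγf : γ = fun t => 2 / s * Real.log (f t) := by
        ext t
        rw [hf, Real.log_exp]
        field_simp
      have h2 : HasDerivAt γ (2 / s * (deriv f t / f t)) t := by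
        rw [hγf]
        exact (hd.hasDerivAt.log hft).const_mul _
      have h3 : deriv f t / f t = s / 2 * deriv γ t := by
        rw [h2.deriv]
        field_simp
      rw [h3]
      exact hβ _
    -- Here `deriv f t` is 0 by convention, so the left side vanishes.
    · rw [deriv_zero_of_not_differentiableAt hd, zero_div, h_zero, mul_zero]
      exact mul_nonneg hβ0 (h_nonneg _)
  have hint : Integrable (fun t => β * (H (deriv γ t) * Real.exp (s * γ t))) μ := by
    refine integrable_of_mem_Icc (c := 0) (C := β * (r * Real.exp (|s| * r))) ?_ fun t => ⟨?_, ?_⟩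
    · exact ((hHc.measurable.comp (measurable_deriv γ)).mul hem).const_mul β
    · exact mul_nonneg hβ0 (mul_nonneg (h_nonneg _) (hexp t).1)
    · exact mul_le_mul_of_nonneg_left (mul_le_mul (hγH t) (hexp t).2 (hexp t).1
        ((h_nonneg _).trans (hγH t))) hβ0
  have hpos : ∀ t, 0 ≤ β * (H (deriv γ t) * Real.exp (s * γ t)) := fun t =>
    mul_nonneg hβ0 (mul_nonneg (h_nonneg _) (hexp t).1)
  have h4 : (κ : ℝ≥0∞) * ∫⁻ t, ENNReal.ofReal (H (deriv f t / f t) * f t ^ 2) ∂μ ≤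
      ENNReal.ofReal (∫ t, β * (H (deriv γ t) * Real.exp (s * γ t)) ∂μ) := by
    rw [ofReal_integral_eq_lintegral_ofReal hint (ae_of_all _ hpos),
      ← lintegral_const_mul' _ _ ENNReal.coe_ne_top]
    refine lintegral_mono fun t => ?_
    rw [← ENNReal.ofReal_coe_nnreal, ← ENNReal.ofReal_mul κ.coe_nonneg, hf2]
    refine ENNReal.ofReal_le_ofReal ?_
    rw [← mul_assoc, ← mul_assoc]
    exact mul_le_mul_of_nonneg_right (hderiv t) (hexp t).1
  have h5 := h1.trans h4
  rw [ENNReal.ofReal_le_ofReal_iff (integral_nonneg hpos)] at h5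
  simp_rw [hf2] at h5
  exact h5

/-- Tensorization adds up the coordinate energies, and `hGH` bounds their sum by G itself, so no
dependence on n remains. -/
theorem ent_pi_exp_mul_le {μ : Measure ℝ} [IsProbabilityMeasure μ]
    (h_nonneg : ∀ x, 0 ≤ H x) (hHc : Continuous H) (h_zero : H 0 = 0) {κ : ℝ≥0}
    (h_mls : ModifiedLogSobolev μ H κ) {s β r : ℝ} (hs : s ≠ 0) (hβ0 : 0 ≤ β)
    (hβ : ∀ p, κ * H (s / 2 * p) ≤ β * H p) {n : ℕ} {G : (Fin n → ℝ) → ℝ} (hG : Continuous G)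
    (hGr : ∀ x, G x ∈ Icc 0 r)
    (hGl : ∀ x i, LocallyLipschitz fun t => G (Function.update x i t))
    (hGH : ∀ x, ∑ i, H (deriv (fun t => G (Function.update x i t)) (x i)) ≤ G x) :
    ent (Measure.pi fun _ : Fin n => μ) (fun x => Real.exp (s * G x)) ≤
      β * ∫ x, G x * Real.exp (s * G x) ∂(Measure.pi fun _ : Fin n => μ) := by
  set h : Fin n → (Fin n → ℝ) → ℝ := fun i x =>
    β * (H (deriv (fun t => G (Function.update x i t)) (x i)) * Real.exp (s * G x)) with hh
  have habs : ∀ x, |s * G x| ≤ |s| * r := fun x => by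
    rw [abs_mul, abs_of_nonneg (hGr x).1]
    exact mul_le_mul_of_nonneg_left (hGr x).2 (abs_nonneg s)
  have hexp : ∀ x, Real.exp (s * G x) ∈ Icc (Real.exp (-(|s| * r))) (Real.exp (|s| * r)) :=
    fun x => ⟨Real.exp_le_exp.2 (abs_le.1 (habs x)).1, Real.exp_le_exp.2 (abs_le.1 (habs x)).2⟩
  have hGi : ∀ x i, H (deriv (fun t => G (Function.update x i t)) (x i)) ≤ G x := fun x i =>
    (Finset.single_le_sum (f := fun i => H (deriv (fun t => G (Function.update x i t)) (x i)))
      (fun i _ => h_nonneg _) (Finset.mem_univ i)).trans (hGH x)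
  have hem : Measurable fun x => Real.exp (s * G x) := by fun_prop
  have hmeas : ∀ i, Measurable (h i) := by
    intro i
    have h1 : Continuous (Function.uncurry fun (x : Fin n → ℝ) (t : ℝ) =>
        G (Function.update x i t)) := by
      refine hG.comp ?_
      exact continuous_fst.update i continuous_snd
    have h2 := (measurable_deriv_with_param h1).comp
      (measurable_id.prodMk (measurable_pi_apply i))
    exact ((hHc.measurable.comp h2).mul hem).const_mul β
  have hbd : ∀ i x, h i x ∈ Icc 0 (β * (r * Real.exp (|s| * r))) := fun i x =>
    ⟨mul_nonneg hβ0 (mul_nonneg (h_nonneg _) (Real.exp_pos _).le),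
      mul_le_mul_of_nonneg_left (mul_le_mul ((hGi x i).trans (hGr x).2) (hexp x).2
        (Real.exp_pos _).le ((hGr x).1.trans (hGr x).2)) hβ0⟩
  refine (ent_pi_le μ (Real.exp_pos _) n _ h hem hexp hmeas hbd fun i x => ?_).trans ?_
  · have hup : ∀ t, deriv (fun t' => G (Function.update (Function.update x i t) i t'))
        (Function.update x i t i) = deriv (fun t' => G (Function.update x i t')) t := by
      intro t
      simp
    have h1 := ent_exp_mul_le_of_modifiedLogSobolev h_nonneg hHc h_zero h_mls hs hβ0 hβ (hGl x i)
      (fun t => hGr _) fun t => by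
        rw [← hup]
        exact (hGi _ i).trans (hGr _).2
    simp only [hh, hup]
    exact h1
  · rw [← integral_const_mul]
    have hGe : Integrable (fun x => β * (G x * Real.exp (s * G x)))
        (Measure.pi fun _ : Fin n => μ) :=
      ((integrable_of_mem_Icc hem hexp).bdd_mul hG.aestronglyMeasurable
        (c := r) (ae_of_all _ fun x => by
          rw [Real.norm_eq_abs, abs_of_nonneg (hGr x).1]; exact (hGr x).2)).const_mul β
    refine integral_mono (integrable_finsetSum _ fun i _ =>
      integrable_of_mem_Icc (hmeas i) (hbd i)) hGe fun x => ?_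
    simp only [hh]
    rw [← Finset.mul_sum, ← Finset.sum_mul]
    exact mul_le_mul_of_nonneg_left
      (mul_le_mul_of_nonneg_right (hGH x) (Real.exp_pos _).le) hβ0

end ModifiedLogSobolev

/-! ### The function ω_H and the constant K. -/

section Omega

variable {H : ℝ → ℝ}

theorem le_toReal_omegaFun_mul (h_nonneg : ∀ x, 0 ≤ H x) (h_even : Function.Even H)
    (h_zero : H 0 = 0) {x : ℝ≥0} (hx : omegaFun H x ≠ ∞) (p : ℝ) :
    H (x * p) ≤ (omegaFun H x).toReal * H p := by
  have key : ∀ t : ℝ, 0 < t → H (x * t) ≤ (omegaFun H x).toReal * H t := by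
    intro t ht
    have h1 : ENNReal.ofReal (H (t * x)) / ENNReal.ofReal (H t) ≤ omegaFun H x :=
      le_iSup₂_of_le t ht le_rfl
    rw [mul_comm (x : ℝ) t]
    rcases (h_nonneg t).eq_or_lt with h0 | h0
    -- If H(t) = 0, the convention c/0 = ∞ and finiteness of ω_H(x) force H(xt) = 0.
    · rw [← h0, mul_zero]
      by_contra! h2
      rw [← h0, ENNReal.ofReal_zero, ENNReal.div_zero (ENNReal.ofReal_pos.2 h2).ne'] at h1
      exact hx (top_le_iff.1 h1)
    · rw [ENNReal.div_le_iff (ENNReal.ofReal_pos.2 h0).ne' ENNReal.ofReal_ne_top,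
        ← ENNReal.ofReal_toReal hx, ← ENNReal.ofReal_mul ENNReal.toReal_nonneg] at h1
      exact (ENNReal.ofReal_le_ofReal_iff (by positivity)).1 h1
  rcases lt_trichotomy p 0 with hp | rfl | hp
  · have := key (-p) (by linarith)
    rwa [mul_neg, h_even, h_even] at this
  · simp [h_zero]
  · exact key p hp

theorem exists_pos_of_bddAbove (h_zero : H 0 = 0)
    (hb : ∀ y, BddAbove (range fun x : ℝ≥0 => (x : ℝ) * |y| - H x)) :
    ∃ t : ℝ, 0 < t ∧ 0 < H t := by
  by_contra! h
  obtain ⟨M, hM⟩ := hb 1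
  have h0 : 0 ≤ M := by simpa [h_zero] using hM ⟨0, rfl⟩
  have h1 : (M + 1) * |(1 : ℝ)| - H (M + 1) ≤ M :=
    hM ⟨(⟨M + 1, by linarith⟩ : ℝ≥0), rfl⟩
  have h2 := h (M + 1) (by linarith)
  rw [abs_one] at h1
  linarith

/-- Used twice: it makes K finite, and ω_H(2) ≥ 4 gives κ ≤ ω_H(2) κ. -/
theorem sq_le_omegaFun (h_even : Function.Even H) (h_zero : H 0 = 0)
    (h_mono : MonotoneOn (fun x => H x / x ^ 2) (Ioi 0)) (hpos : ∃ t : ℝ, 0 < t ∧ 0 < H t)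
    {x : ℝ≥0} (hx : 1 ≤ x) : (x : ℝ≥0∞) ^ 2 ≤ omegaFun H x := by
  obtain ⟨t, ht, hHt⟩ := hpos
  refine le_iSup₂_of_le t ht ?_
  rw [ENNReal.le_div_iff_mul_le (Or.inl (ENNReal.ofReal_pos.2 hHt).ne')
    (Or.inl ENNReal.ofReal_ne_top), ← ENNReal.ofReal_coe_nnreal, ← ENNReal.ofReal_pow x.coe_nonneg,
    ← ENNReal.ofReal_mul (by positivity), mul_comm t]
  exact ENNReal.ofReal_le_ofReal (sq_mul_le_of_monotoneOn_div_sq h_even h_zero h_mono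
    (by exact_mod_cast hx) t)

/-- Moving the factor c = ω_H(2) κ inside exhibits K as the supremum of the rates x - c ω_H(x). -/
theorem concConst_eq_iSup {κ : ℝ≥0} (h0 : omegaFun H 2 * κ ≠ 0) (ht : omegaFun H 2 * κ ≠ ∞) :
    concConst H κ = ⨆ x : ℝ≥0, ((x : ℝ≥0∞) - omegaFun H 2 * κ * omegaFun H x) := by
  rw [concConst, conjRay, ENNReal.mul_iSup]
  refine iSup_congr fun x => ?_
  rw [ENNReal.mul_sub fun _ _ => ht, one_div, mul_comm (x : ℝ≥0∞), ← mul_assoc,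
    ENNReal.mul_inv_cancel h0 ht, one_mul]

theorem concConst_eq_zero {κ : ℝ≥0} (h : omegaFun H 2 * κ = 0 ∨ omegaFun H 2 * κ = ∞) :
    concConst H κ = 0 := by
  rcases h with h | h <;> simp [concConst, conjRay, h]

theorem concConst_ne_top {κ : ℝ≥0} (hω : ∀ x : ℝ≥0, 1 ≤ x → (x : ℝ≥0∞) ^ 2 ≤ omegaFun H x) :
    concConst H κ ≠ ∞ := by
  by_cases h : omegaFun H 2 * κ = 0 ∨ omegaFun H 2 * κ = ∞
  · simp [concConst_eq_zero h]
  · push Not at h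
    rw [concConst_eq_iSup h.1 h.2]
    set c := omegaFun H 2 * κ
    -- For x ≥ 1 and x ≥ 1/c, c ω_H(x) ≥ cx² ≥ x, so the truncated term is 0; otherwise it is at
    -- most x ≤ 1 + 1/c.
    refine ne_top_of_le_ne_top (b := 1 + c⁻¹)
      (ENNReal.add_ne_top.2 ⟨ENNReal.one_ne_top, ENNReal.inv_ne_top.2 h.1⟩) (iSup_le fun x => ?_)
    rcases le_total x 1 with hx | hx
    · exact tsub_le_self.trans ((by exact_mod_cast hx : (x : ℝ≥0∞) ≤ 1).trans le_self_add)
    rcases le_total (x : ℝ≥0∞) c⁻¹ with hxc | hxc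
    · exact tsub_le_self.trans (hxc.trans le_add_self)
    · rw [tsub_eq_zero_of_le]
      · exact zero_le
      · calc (x : ℝ≥0∞) = c * c⁻¹ * x := by rw [ENNReal.mul_inv_cancel h.1 h.2, one_mul]
          _ ≤ c * x * x := by gcongr
          _ = c * (x : ℝ≥0∞) ^ 2 := by ring
          _ ≤ c * omegaFun H x := by gcongr; exact hω x hx

end Omega

/-! ### Concentration at a fixed rate. -/

section Concentration

open Filter Topology

variable {H : ℝ → ℝ} {μ : Measure ℝ} [IsProbabilityMeasure μ]

theorem measureReal_infConv_ge_le (h_nonneg : ∀ x, 0 ≤ H x) (h_even : Function.Even H)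
    (h_convex : ConvexOn ℝ univ H) (h_zero : H 0 = 0)
    (h_mono : MonotoneOn (fun x => H x / x ^ 2) (Ioi 0))
    (h_strict : StrictConvexOn ℝ univ (legendre H))
    {κ : ℝ≥0} (h_mls : ModifiedLogSobolev μ H κ) {k W : ℝ} (hk : 0 < k) (hW0 : 0 ≤ W)
    (hW : ∀ p, H (k / 2 * p) ≤ W * H p) (hbk : κ * W / k < 1)
    {n : ℕ} {A : Set (Fin n → ℝ)} (hA : IsCompact A)
    (hPA : 0 < (Measure.pi fun _ : Fin n => μ).real A) {r : ℝ} (hr : 0 ≤ r) :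
    (Measure.pi fun _ : Fin n => μ).real {x | r ≤ infConv (legendre H) A x} ≤
      Real.exp (-k * r + (1 + κ * W / k) / (1 - κ * W / k) *
        -Real.log ((Measure.pi fun _ : Fin n => μ).real A)) := by
  have hb := bddAbove_legendre h_nonneg h_zero h_mono h_strict
  have hL := h_strict.convexOn
  have h0 := legendre_nonneg h_even h_zero hb
  have hL0 := legendre_zero h_nonneg h_zero
  have hne : A.Nonempty := by
    by_contra h
    rw [not_nonempty_iff_eq_empty.1 h] at hPA
    simp at hPA
  set G : (Fin n → ℝ) → ℝ := fun x => min (infConv (legendre H) A x) r with hG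
  have hGc : Continuous G :=
    (continuous_infConv hL.locallyLipschitz.continuous hA).min continuous_const
  have hGr : ∀ x, G x ∈ Icc 0 r := fun x =>
    ⟨le_min (infConv_nonneg h0 x) hr, min_le_right _ _⟩
  have hk2 : κ * W / k = κ * W / k ^ 2 * k := by field_simp
  have hset : {x | r ≤ infConv (legendre H) A x} = {x | r ≤ G x} := by
    ext x
    simp [hG]
  rw [hset, hk2]
  refine measureReal_ge_le_of_ent_le hGc.measurable hGr (by positivity) hk (hk2 ▸ hbk)
    (fun s hs hs0 => ?_) hA.measurableSet (fun x hx => ?_) hPA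
  · refine ent_pi_exp_mul_le h_nonneg h_convex.locallyLipschitz.continuous h_zero h_mls hs0
      (by positivity) (fun p => ?_) hGc hGr
      (fun x i => (locallyLipschitz_infConv_update hL.locallyLipschitz h0 hA hne x i).min_const r)
      (sum_deriv_min_infConv_le hL h0 h_zero
        (fun p u => le_legendre_of_subgradient h_even h_convex h_zero h_mono hb) hA hne hr)
    have hs1 : 0 < |s| := abs_pos.2 hs0
    -- Quadratic growth transfers `hW` from k to every |s| ≤ k with a gain (s/k)², whence b = κW/k²;
    -- evenness handles the sign of s.
    have h1 := sq_mul_le_of_monotoneOn_div_sq h_even h_zero h_mono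
      (a := k / |s|) (by rwa [one_le_div hs1]) (s / 2 * p)
    have h2 : H (k / |s| * (s / 2 * p)) = H (k / 2 * p) := by
      rcases abs_cases s with h | h <;> rw [h.1]
      · congr 1
        field_simp
      · rw [← h_even]
        congr 1
        field_simp
    rw [h2, div_pow, sq_abs] at h1
    have h3 := h1.trans (hW p)
    have h4 : H (s / 2 * p) ≤ s ^ 2 / k ^ 2 * (W * H p) := by
      have h5 : H (s / 2 * p) = s ^ 2 / k ^ 2 * (k ^ 2 / s ^ 2 * H (s / 2 * p)) := by
        field_simp
      rw [h5]
      gcongr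
    calc κ * H (s / 2 * p) ≤ κ * (s ^ 2 / k ^ 2 * (W * H p)) := by gcongr
      _ = κ * W / k ^ 2 * s ^ 2 * H p := by ring
  · simp only [hG]
    rw [infConv_eq_zero h0 hL0 hx, min_eq_left hr]

theorem one_sub_measureReal_add_le (h_nonneg : ∀ x, 0 ≤ H x) (h_even : Function.Even H)
    (h_convex : ConvexOn ℝ univ H) (h_zero : H 0 = 0)
    (h_mono : MonotoneOn (fun x => H x / x ^ 2) (Ioi 0))
    (h_strict : StrictConvexOn ℝ univ (legendre H))
    {κ : ℝ≥0} (h_mls : ModifiedLogSobolev μ H κ) {k W c : ℝ} (hk : 0 < k) (hW0 : 0 ≤ W)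
    (hW : ∀ p, H (k * p) ≤ W * H p) (hc : κ ≤ c) (hck : c * W < k)
    {n : ℕ} {A : Set (Fin n → ℝ)} (hA : MeasurableSet A)
    (hPA : 1 / 2 ≤ (Measure.pi fun _ : Fin n => μ) A) {r : ℝ} (hr : 0 < r) :
    1 - (Measure.pi fun _ : Fin n => μ).real
        (A + {x : Fin n → ℝ | ∑ i, legendre H (x i) < r}) ≤
      Real.exp (-((k - c * W) * r)) := by
  have hb := bddAbove_legendre h_nonneg h_zero h_mono h_strict
  have hLc := h_strict.convexOn.locallyLipschitz.continuous
  have hL0 := legendre_zero h_nonneg h_zero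
  set P := Measure.pi fun _ : Fin n => μ with hP
  set S := A + {x : Fin n → ℝ | ∑ i, legendre H (x i) < r} with hS
  set q := 1 - P.real S with hq
  set η := κ * W / (2 * k) with hη
  have hη0 : 0 ≤ η := by positivity
  have hκW : κ * W ≤ c * W := by gcongr
  have hη1 : η < 1 := by
    rw [hη, div_lt_one (by positivity)]
    linarith
  have hAr : 1 / 2 ≤ P.real A := by
    have := ENNReal.toReal_mono (measure_ne_top P A) hPA
    simpa [Measure.real] using this
  have hq1 : q ≤ 1 / 2 := by
    have : P.real A ≤ P.real S := measureReal_mono fun x hx =>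
      ⟨x, hx, 0, by simpa [hL0] using hr, add_zero x⟩
    linarith
  have hcompact : ∀ a : ℝ, 0 < a → a < 1 / 2 →
      q ≤ Real.exp (-(2 * k) * r + (1 + η) / (1 - η) * -Real.log a) := by
    intro a ha0 ha
    obtain ⟨B, hBA, hB, hBa⟩ := hA.exists_lt_isCompact_of_ne_top (measure_ne_top P A)
      (r := ENNReal.ofReal a) (by
        rw [← ofReal_measureReal (measure_ne_top P A)]
        exact (ENNReal.ofReal_lt_ofReal_iff (by linarith)).2 (by linarith))
    have hBa' : a < P.real B := by
      rw [← ofReal_measureReal (measure_ne_top P B)] at hBa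
      exact (ENNReal.ofReal_lt_ofReal_iff_of_nonneg ha0.le).1 hBa
    have hne : B.Nonempty := by
      by_contra h
      rw [not_nonempty_iff_eq_empty.1 h] at hBa'
      simp at hBa'
      linarith
    -- The Laplace parameter is 2k because the test function exp(sG/2) halves it; then bk becomes
    -- `η`.
    have h1 := measureReal_infConv_ge_le h_nonneg h_even h_convex h_zero h_mono h_strict h_mls
      (k := 2 * k) (by positivity) hW0 (fun p => by simpa using hW p) hη1 hB
      (ha0.trans hBa') hr.le
    have hm : MeasurableSet {x | infConv (legendre H) B x < r} :=
      measurableSet_lt (continuous_infConv hLc hB).measurable measurable_const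
    have h2 : q ≤ P.real {x | r ≤ infConv (legendre H) B x} := by
      have h3 : {x | r ≤ infConv (legendre H) B x} = {x | infConv (legendre H) B x < r}ᶜ := by
        ext x
        simp
      rw [h3, probReal_compl_eq_one_sub hm]
      -- Where the infimum is below `r`, its minimizer decomposes x as a point of `B` plus a vector
      -- of cost below `r`.
      refine sub_le_sub_left (measureReal_mono fun x hx => ?_) 1
      obtain ⟨y, hy, hxy⟩ := exists_infConv_eq hLc hB hne x
      exact ⟨y, hBA hy, x - y, by simpa [hxy] using hx, add_sub_cancel y x⟩
    refine h2.trans (h1.trans (Real.exp_le_exp.2 ?_))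
    have h4 := Real.log_le_log ha0 hBa'.le
    have h5 : 0 ≤ (1 + η) / (1 - η) := div_nonneg (by linarith) (by linarith)
    have h6 := mul_le_mul_of_nonneg_left (neg_le_neg h4) h5
    linarith
  have hlim : q ≤ Real.exp (-(2 * k) * r + (1 + η) / (1 - η) * Real.log 2) := by
    have h1 : Tendsto (fun a : ℝ => Real.exp (-(2 * k) * r + (1 + η) / (1 - η) * -Real.log a))
        (𝓝[<] (1 / 2)) (𝓝 (Real.exp (-(2 * k) * r + (1 + η) / (1 - η) * -Real.log (1 / 2)))) := by
      have : ContinuousAt (fun a : ℝ =>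
          Real.exp (-(2 * k) * r + (1 + η) / (1 - η) * -Real.log a)) (1 / 2) := by
        have h := Real.continuousAt_log (x := 1 / 2) (by norm_num)
        exact ((h.neg.const_mul _).const_add _).rexp
      exact this.tendsto.mono_left nhdsWithin_le_nhds
    rw [one_div, Real.log_inv, neg_neg] at h1
    refine ge_of_tendsto h1 ?_
    filter_upwards [Ioo_mem_nhdsLT (a := (0 : ℝ)) (b := 2⁻¹) (by norm_num)] with a ha
    exact hcompact a ha.1 (by simpa using ha.2)
  -- For small `r` the bound q ≤ 1/2 suffices. For large `r`, log 2 ≤ (k - cW)r turns the prefactor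
  -- into at most (k + cW)r, and -2k + (k + cW) = -(k - cW).
  rcases le_total ((k - c * W) * r) (Real.log 2) with h | h
  · refine hq1.trans ?_
    rw [one_div, ← Real.exp_log (by norm_num : (0 : ℝ) < 2⁻¹), Real.log_inv]
    exact Real.exp_le_exp.2 (neg_le_neg h)
  · refine hlim.trans (Real.exp_le_exp.2 ?_)
    have hd : 0 < k - c * W := by linarith
    have h1 : (1 + η) / (1 - η) ≤ (k + c * W) / (k - c * W) := by
      rw [div_le_div_iff₀ (by linarith) hd]
      have h2 : η * k ≤ c * W := by
        have : η * k = κ * W / 2 := by rw [hη]; field_simp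
        have : 0 ≤ κ * W := by positivity
        linarith
      nlinarith
    have h3 : (k + c * W) / (k - c * W) * Real.log 2 ≤ (k + c * W) * r := by
      have h4 : 0 ≤ (k + c * W) / (k - c * W) := by
        have : 0 ≤ κ * W := by positivity
        exact div_nonneg (by linarith) hd.le
      calc (k + c * W) / (k - c * W) * Real.log 2
          ≤ (k + c * W) / (k - c * W) * ((k - c * W) * r) := by gcongr
        _ = (k + c * W) * r := by field_simp
    have h5 : (1 + η) / (1 - η) * Real.log 2 ≤ (k + c * W) / (k - c * W) * Real.log 2 :=
      mul_le_mul_of_nonneg_right h1 (Real.log_nonneg (by norm_num))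
    linarith

end Concentration

/-! ### Optimization over the rate. -/

theorem mainTheorem11 (μ : Measure ℝ) [IsProbabilityMeasure μ] (hμ : μ ≪ volume)
    (H : ℝ → ℝ) (h_nonneg : ∀ x, 0 ≤ H x) (h_even : Function.Even H)
    (h_convex : ConvexOn ℝ univ H) (h_zero : H 0 = 0)
    (h_mono : MonotoneOn (fun x => H x / x ^ 2) (Ioi 0))
    (h_strict : StrictConvexOn ℝ univ (legendre H))
    (κ : ℝ≥0) (h_mls : ModifiedLogSobolev μ H κ) :
    concConst H κ ≠ ∞ ∧
      ∀ (n : ℕ) (A : Set (Fin n → ℝ)), MeasurableSet A →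
        1 / 2 ≤ (Measure.pi fun _ : Fin n => μ) A →
        ∀ r : ℝ, 0 ≤ r →
          1 - (Measure.pi fun _ : Fin n => μ).real
              (A + {x : Fin n → ℝ | ∑ i, legendre H (x i) < r})
            ≤ Real.exp (-((concConst H κ).toReal * r)) := by
  have hb := bddAbove_legendre h_nonneg h_zero h_mono h_strict
  have hω : ∀ x : ℝ≥0, 1 ≤ x → (x : ℝ≥0∞) ^ 2 ≤ omegaFun H x := fun x hx =>
    sq_le_omegaFun h_even h_zero h_mono (exists_pos_of_bddAbove h_zero hb) hx
  refine ⟨concConst_ne_top hω, fun n A hA hPA r hr => ?_⟩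
  have hq1 : 1 - (Measure.pi fun _ : Fin n => μ).real
      (A + {x : Fin n → ℝ | ∑ i, legendre H (x i) < r}) ≤ 1 := sub_le_self _ measureReal_nonneg
  by_cases h : omegaFun H 2 * κ = 0 ∨ omegaFun H 2 * κ = ∞
  · simp [concConst_eq_zero h]
  push Not at h
  rcases hr.eq_or_lt with rfl | hr0
  · simp
  have hmain := fun (k W c : ℝ) hk hW0 hW hc hck =>
    one_sub_measureReal_add_le h_nonneg h_even h_convex h_zero h_mono h_strict h_mls
      (k := k) (W := W) (c := c) hk hW0 hW hc hck hA hPA hr0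
  set q := 1 - (Measure.pi fun _ : Fin n => μ).real
    (A + {x : Fin n → ℝ | ∑ i, legendre H (x i) < r})
  rcases le_or_gt q 0 with hq0 | hq0
  · exact hq0.trans (Real.exp_pos _).le
  set c := omegaFun H 2 * κ with hc
  have hκc : (κ : ℝ) ≤ c.toReal := by
    have h1 : (κ : ℝ≥0∞) ≤ c := by
      rw [hc]
      refine le_mul_of_one_le_left (zero_le) (le_trans ?_ (hω 2 (by norm_num)))
      norm_num
    simpa using ENNReal.toReal_mono h.2 h1
  have hlog : 0 ≤ -Real.log q / r :=
    div_nonneg (neg_nonneg.2 (Real.log_nonpos hq0.le hq1)) hr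
  -- The claim is K ≤ -log q / r, which can be checked on each term of the supremum: the fixed-rate
  -- bound with k = x and W = ω_H(x) applies whenever the term is positive.
  have hK : concConst H κ ≤ ENNReal.ofReal (-Real.log q / r) := by
    rw [concConst_eq_iSup h.1 h.2]
    refine iSup_le fun x => ?_
    rcases le_or_gt (x : ℝ≥0∞) (c * omegaFun H x) with hx | hx
    · rw [tsub_eq_zero_of_le hx]
      exact zero_le
    have hωx : omegaFun H x ≠ ∞ := by
      intro h'
      rw [h', ENNReal.mul_top h.1] at hx
      exact not_top_lt hx
    have hck : c.toReal * (omegaFun H x).toReal < x := by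
      rw [← ENNReal.toReal_mul]
      simpa using (ENNReal.toReal_lt_toReal (ENNReal.mul_ne_top h.2 hωx) ENNReal.coe_ne_top).2 hx
    have h2 := hmain x (omegaFun H x).toReal c.toReal
      ((mul_nonneg ENNReal.toReal_nonneg ENNReal.toReal_nonneg).trans_lt hck)
      ENNReal.toReal_nonneg (le_toReal_omegaFun_mul h_nonneg h_even h_zero hωx) hκc hck
    rw [← Real.log_le_iff_le_exp hq0] at h2
    rw [← ENNReal.ofReal_toReal (ENNReal.mul_ne_top h.2 hωx), ← ENNReal.ofReal_coe_nnreal,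
      ← ENNReal.ofReal_sub _ ENNReal.toReal_nonneg, ENNReal.toReal_mul]
    refine ENNReal.ofReal_le_ofReal ?_
    rw [le_div_iff₀ hr0]
    linarith
  have h3 := ENNReal.toReal_le_of_le_ofReal hlog hK
  rw [le_div_iff₀ hr0] at h3
  rw [← Real.log_le_iff_le_exp hq0]
  linarith
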